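/- **Theorem (Cramér–Rao bound for unbiased estimators of the entire parameter $\theta$).** *Model.* Let $L,M,N\ge 0$ be integers, $P=M+L$, $\gamma>0$, and let $F\in\mathbb C^{P\times M}$ be a precoding matrix (in particular, any full-rank one). For a vector $v$ let $\mathcal T_v$ be the banded Toeplitz matrix with entries $(\mathcal T_v)_{ij}=v_{i-j}$ (zero when $i-j$ is not an index of $v$), of the size for which $\mathcal T_v w$ is the full convolution of $v$ and $w$. The channel vector is $h\in\mathbb C^{L+1}$, the channel input is $x=(I_N\otimes F)s\in\mathbb C^{NP}$, with source symbols $\sqrt\gamma\,s$, and the receiver observes $$y=\sqrt\gamma\,\mathcal T_h x+n\in\mathbb C^{NP+L},$$ where $n$ is circularly-symmetric complex Gaussian with mean $0$ and covariance $I$; let $p(y;\theta)$ be the density of $y$. The pilot symbols impose $As=c$, with a constant matrix $A$ and a constant vector $c$. Let $U_n$ have orthonormal columns spanning the orthogonal complement of the column space of $I_N\otimes F$, let $$C=\begin{bmatrix}U_n^H\\ A(I_N\otimes F)^\dagger\end{bmatrix},$$ with $\dagger$ the Moore–Penrose inverse, and let the parameter space be $$\Theta=\Big\{\theta=\begin{bmatrix}h\\x\end{bmatrix}\in\mathbb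 C^{NP+L+1}:\ Cx=\begin{bmatrix}0\\c\end{bmatrix}\Big\}.$$ Let $E=\operatorname{diag}(I_{L+1},\tilde E)$, where $\tilde E$ is any matrix with orthonormal columns such that $C\tilde E=0$ (in particular, one whose columns form an orthonormal basis of the null space of $C$). *Claim.* Let $\theta=[h;x]\in\Theta$. The complex Fisher information matrix $J=\mathsf E[vv^H]$, where $v=\partial\ln p(y;\theta)/\partial\theta^*$ is the complex (Wirtinger) score, equals $$J=\gamma\,[\mathcal T_x\ \ \mathcal T_h]^H[\mathcal T_x\ \ \mathcal T_h].$$ Moreover, let $\hat\theta(y)$ be an estimator with finite second moments under $p(\cdot\,;\theta)$ that is unbiased, i.e. $\mathsf E_{\theta'}[\hat\theta]=\theta'$ for all $\theta'\in\Theta$, or, more generally, unbiased to first order at $\theta$, i.e. $\mathsf E_{\theta}[\hat\theta]=\theta$ and $\mathsf E_{\theta'}[\hat\theta]=\theta'+o(\|\theta'-\theta\|)$ as $\theta'\to\theta$ within $\Theta$. Then $E^HJE$ is invertible and $$\mathsf{cov}(\hat\theta)=\mathsf E_\theta\big[(\hat\theta-\mathsf E_\theta\hat\theta)(\hat\theta-\mathsf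 E_\theta\hat\theta)^H\big]\ \ge\ E\,(E^HJE)^{-1}E^H,$$ where $X\ge Y$ means that $X-Y$ is Hermitian and nonnegative-definite. -/

import Mathlib

open Matrix MeasureTheory
open scoped ComplexOrder Kronecker

noncomputable section

namespace SemiBlind

/-- The Moore-Penrose inverse `A† = (Aᴴ A)† Aᴴ`; the Hermitian matrix `Aᴴ A` is pseudo-inverted by
inverting its nonzero eigenvalues (in Lean `0⁻¹ = 0`). -/
def pinv {m n : ℕ} (A : Matrix (Fin m) (Fin n) ℂ) : Matrix (Fin n) (Fin m) ℂ :=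
  cfc (fun t : ℝ => t⁻¹) (Aᴴ * A) * Aᴴ

/-- The four Penrose conditions, which characterise the Moore-Penrose inverse. -/
theorem pinv_penrose {m n : ℕ} (A : Matrix (Fin m) (Fin n) ℂ) :
    A * pinv A * A = A ∧ pinv A * A * pinv A = pinv A ∧
      (A * pinv A).IsHermitian ∧ (pinv A * A).IsHermitian := by
  have hH : IsSelfAdjoint (Aᴴ * A) := isHermitian_conjTranspose_mul_self A
  have hfin : (spectrum ℝ (Aᴴ * A)).Finite := Matrix.finite_real_spectrum
  have hc : ∀ f : ℝ → ℝ, ContinuousOn f (spectrum ℝ (Aᴴ * A)) := fun f => hfin.continuousOn f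
  set H := Aᴴ * A with hHdef
  set G := cfc (fun t : ℝ => t⁻¹) H with hG
  have hGs : Gᴴ = G := (cfc_predicate (fun t : ℝ => t⁻¹) H : IsSelfAdjoint G)
  have hGH : G * H = cfc (fun t : ℝ => t⁻¹ * t) H := by
    rw [cfc_mul _ _ H (hc _) (hc _), cfc_id' ℝ H]
  have hGHs : (G * H)ᴴ = G * H := by
    rw [hGH]
    exact (cfc_predicate (fun t : ℝ => t⁻¹ * t) H : IsSelfAdjoint _)
  have hGHG : G * H * G = G := by
    rw [hGH, hG, ← cfc_mul _ _ H (hc _) (hc _)]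
    congr 1
    funext t
    by_cases ht : t = 0 <;> simp [ht]
  have hHGH : H * (G * H) = H := by
    rw [hGH]
    nth_rewrite 1 [← cfc_id' ℝ H]
    rw [← cfc_mul _ _ H (hc _) (hc _)]
    refine Eq.trans ?_ (cfc_id' ℝ H)
    congr 1
    funext t
    by_cases ht : t = 0 <;> simp [ht]
  have hp : pinv A = G * Aᴴ := rfl
  have hpA : pinv A * A = G * H := by rw [hp, Matrix.mul_assoc]
  have h1 : A * (G * H) = A := by
    have h0 : Aᴴ * A * (1 - G * H) = 0 := by
      rw [← hHdef, Matrix.mul_sub, hHGH, Matrix.mul_one, sub_self]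
    rw [conjTranspose_mul_self_mul_eq_zero, Matrix.mul_sub, Matrix.mul_one, sub_eq_zero] at h0
    exact h0.symm
  refine ⟨?_, ?_, ?_, ?_⟩
  · rw [Matrix.mul_assoc, hpA, h1]
  · rw [hpA, hp, ← Matrix.mul_assoc, hGHG]
  · rw [hp, IsHermitian, conjTranspose_mul, conjTranspose_mul, conjTranspose_conjTranspose, hGs,
      Matrix.mul_assoc]
  · rw [hpA]
    exact hGHs

/-- The banded Toeplitz matrix `𝒯_v` with `n` columns: the entry `(i, j)` is `v_{i-j}`, and `0` when
`i - j` is not an index of `v`. For `v` of length `m` it is used with `r = m + n - 1` rows, so that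
`𝒯_v *ᵥ w` is the full convolution of `v` and `w`. -/
def toeplitz (r n : ℕ) {m : ℕ} (v : Fin m → ℂ) : Matrix (Fin r) (Fin n) ℂ :=
  Matrix.of fun i j =>
    if hij : j.val ≤ i.val ∧ i.val - j.val < m then v ⟨i.val - j.val, hij.2⟩ else 0

/-- `I_N ⊗ F`, for a `P × M` precoder `F`, as an `NP × NM` matrix. -/
def blockPrecoder {P M : ℕ} (N : ℕ) (F : Matrix (Fin P) (Fin M) ℂ) :
    Matrix (Fin (N * P)) (Fin (N * M)) ℂ :=
  Matrix.reindex finProdFinEquiv finProdFinEquiv ((1 : Matrix (Fin N) (Fin N) ℂ) ⊗ₖ F)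

/-- Indices of `θ = [h; x]`, with `h` of length `L + 1` and `x` of length `K`. -/
abbrev Idx (L K : ℕ) := Fin (L + 1) ⊕ Fin K

/-- The channel vector `h` of `θ = [h; x]`. -/
def chan {L K : ℕ} (θ : Idx L K → ℂ) : Fin (L + 1) → ℂ := fun i => θ (Sum.inl i)

/-- The channel input `x` of `θ = [h; x]`. -/
def inp {L K : ℕ} (θ : Idx L K → ℂ) : Fin K → ℂ := fun i => θ (Sum.inr i)

/-- The matrix `[𝒯_x 𝒯_h]`. -/
def toeplitzPair {L K : ℕ} (θ : Idx L K → ℂ) : Matrix (Fin (K + L)) (Idx L K) ℂ :=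
  Matrix.fromCols (toeplitz (K + L) (L + 1) (inp θ)) (toeplitz (K + L) K (chan θ))

/-- The noiseless received signal `√γ 𝒯_h x`. -/
def signal {L K : ℕ} (γ : ℝ) (θ : Idx L K → ℂ) : Fin (K + L) → ℂ :=
  (Real.sqrt γ : ℂ) • (toeplitz (K + L) K (chan θ) *ᵥ inp θ)

/-- The density `p(y; θ)` of `y = √γ 𝒯_h x + n`, where `n` is circularly-symmetric complex Gaussian
with mean `0` and covariance `I`. -/
def pdf {L K : ℕ} (γ : ℝ) (θ : Idx L K → ℂ) (y : Fin (K + L) → ℂ) : ℝ :=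
  (Real.pi ^ (K + L))⁻¹ * Real.exp (-∑ i, ‖y i - signal γ θ i‖ ^ 2)

/-- The law of the observation `y` under the parameter `θ`. -/
def law {L K : ℕ} (γ : ℝ) (θ : Idx L K → ℂ) : Measure (Fin (K + L) → ℂ) :=
  volume.withDensity fun y => ENNReal.ofReal (pdf γ θ y)

/-- The Wirtinger derivative `∂g/∂z_k^* = (∂g/∂α_k + j ∂g/∂β_k) / 2`, where `z_k = α_k + j β_k`. -/
def wirtingerConj {ι : Type} [Fintype ι] [DecidableEq ι] (g : (ι → ℂ) → ℂ) (z : ι → ℂ) (k : ι) :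
    ℂ :=
  (1 / 2) * (fderiv ℝ g z (Pi.single k 1) + Complex.I * fderiv ℝ g z (Pi.single k Complex.I))

/-- The complex score `v(y; θ) = ∂ ln p(y; θ) / ∂θ^*`. -/
def score {L K : ℕ} (γ : ℝ) (θ : Idx L K → ℂ) (y : Fin (K + L) → ℂ) : Idx L K → ℂ :=
  fun k => wirtingerConj (fun θ' : Idx L K → ℂ => (Real.log (pdf γ θ' y) : ℂ)) θ k

/-- The complex Fisher information matrix `J = E[v vᴴ]`. -/
def fisherInfo {L K : ℕ} (γ : ℝ) (θ : Idx L K → ℂ) : Matrix (Idx L K) (Idx L K) ℂ :=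
  Matrix.of fun k l => ∫ y, score γ θ y k * star (score γ θ y l) ∂(law γ θ)

/-- The matrix `[U_nᴴ; A (I ⊗ F)†]` of the precoding and pilot constraints on `x`, where
`B = I ⊗ F`. -/
def constraintMatrix {K S r q : ℕ} (B : Matrix (Fin K) (Fin S) ℂ) (U : Matrix (Fin K) (Fin r) ℂ)
    (A : Matrix (Fin q) (Fin S) ℂ) : Matrix (Fin r ⊕ Fin q) (Fin K) ℂ :=
  Matrix.fromRows Uᴴ (A * pinv B)

/-- The parameter space: all `θ = [h; x]` with `U_nᴴ x = 0` and `A (I ⊗ F)† x = c`. -/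
def paramSpace (L : ℕ) {K S r q : ℕ} (B : Matrix (Fin K) (Fin S) ℂ) (U : Matrix (Fin K) (Fin r) ℂ)
    (A : Matrix (Fin q) (Fin S) ℂ) (c : Fin q → ℂ) : Set (Idx L K → ℂ) :=
  {θ | constraintMatrix B U A *ᵥ inp θ - Sum.elim (0 : Fin r → ℂ) c = 0}

/-- `U` has orthonormal columns, which span the null space of `Bᴴ`, that is, the orthogonal
complement of the column space of `B`. -/
def IsNullBasis {K S r : ℕ} (B : Matrix (Fin K) (Fin S) ℂ) (U : Matrix (Fin K) (Fin r) ℂ) : Prop :=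
  Uᴴ * U = 1 ∧ LinearMap.range U.mulVecLin = LinearMap.ker Bᴴ.mulVecLin

/-- `E = diag(I, Ẽ)`. -/
def complementMatrix (L : ℕ) {K d : ℕ} (Et : Matrix (Fin K) (Fin d) ℂ) :
    Matrix (Idx L K) (Idx L d) ℂ :=
  Matrix.fromBlocks 1 0 0 Et

/-- `est` is an unbiased estimator of `θ` over the parameter space `Θ`. -/
def IsUnbiased {L K : ℕ} (γ : ℝ) (Θ : Set (Idx L K → ℂ))
    (est : (Fin (K + L) → ℂ) → Idx L K → ℂ) : Prop :=
  ∀ θ ∈ Θ, Integrable est (law γ θ) ∧ ∫ y, est y ∂(law γ θ) = θ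

/-- `est` is unbiased to first order at the point `θ` of `Θ`: `E_θ[est] = θ` and
`E_θ'[est] = θ' + o(‖θ' - θ‖)` as `θ'` tends to `θ` within `Θ`. -/
def IsUnbiasedToFirstOrder {L K : ℕ} (γ : ℝ) (Θ : Set (Idx L K → ℂ)) (θ : Idx L K → ℂ)
    (est : (Fin (K + L) → ℂ) → Idx L K → ℂ) : Prop :=
  ∫ y, est y ∂(law γ θ) = θ ∧
    HasFDerivWithinAt (fun θ' => ∫ y, est y ∂(law γ θ'))
      (ContinuousLinearMap.id ℝ (Idx L K → ℂ)) Θ θ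

/-- `cov(u) = E[(u - E u) (u - E u)ᴴ]`. -/
def cov {Ω ι : Type} [MeasurableSpace Ω] (μ : Measure Ω) (u : Ω → ι → ℂ) : Matrix ι ι ℂ :=
  Matrix.of fun k l =>
    ∫ y, (u y k - ∫ w, u w k ∂μ) * star (u y l - ∫ w, u w l ∂μ) ∂μ

end SemiBlind

end

/-! Write `μ` for the noiseless signal, `n = y - μ` for the noise and `D = √γ [𝒯_x 𝒯_h]` for the
Jacobian of `μ`, complex-linear because convolution is bilinear. The Gaussian score is `v = Dᴴ n`
(`score_eq`), and `E[n nᴴ] = I` gives `J = Dᴴ D`.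

A statistic with finite second moments under one Gaussian law has a mean differentiable in the
location there (`hasFDerivAt_integral_complexGaussian`). Differentiating the unbiasedness relation
along `δ` and `iδ`, for `δ` in the range of `E`, and combining the two real identities gives `E[θ̂
nᴴ] D E = E` (`crossMoment_noise_mulVec`).

This identity does two things. Multiplied by `Eᴴ` it gives `D E` a left inverse, so `Eᴴ J E` is
positive definite: the existence of the estimator forces identifiability. It also says `E[e vᴴ] E =
E` for the centred error `e`; with `B = E (Eᴴ J E)⁻¹ Eᴴ`, the second-moment matrix of `e - B v` is
then `cov - B`, hence nonnegative (`posSemidef_crossMoment_sub`). -/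

noncomputable section

namespace SemiBlind

/-! ### The complex Gaussian law and its moments. -/

/-- The density of the circularly-symmetric complex Gaussian law with mean `a` and covariance `I`. -/
def gaussDensity {n : ℕ} (a y : Fin n → ℂ) : ℝ :=
  (Real.pi ^ n)⁻¹ * Real.exp (-∑ i, ‖y i - a i‖ ^ 2)

/-- The circularly-symmetric complex Gaussian law with mean `a` and covariance `I`. -/
def complexGaussian {n : ℕ} (a : Fin n → ℂ) : Measure (Fin n → ℂ) :=
  volume.withDensity fun y => ENNReal.ofReal (gaussDensity a y)

theorem law_eq_complexGaussian {L K : ℕ} (γ : ℝ) (θ : Idx L K → ℂ) :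
    law γ θ = complexGaussian (signal γ θ) := rfl

theorem gaussDensity_pos {n : ℕ} (a y : Fin n → ℂ) : 0 < gaussDensity a y := by
  unfold gaussDensity
  positivity

theorem continuous_gaussDensity {n : ℕ} (a : Fin n → ℂ) : Continuous (gaussDensity a) := by
  unfold gaussDensity
  fun_prop

section Change

variable {n : ℕ} {V : Type*} [NormedAddCommGroup V] [NormedSpace ℝ V]

theorem integral_complexGaussian (a : Fin n → ℂ) (f : (Fin n → ℂ) → V) :
    ∫ y, f y ∂complexGaussian a = ∫ y, gaussDensity a y • f y := by
  unfold complexGaussian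
  rw [integral_withDensity_eq_integral_toReal_smul
    (continuous_gaussDensity a).measurable.ennreal_ofReal (by simp)]
  simp [ENNReal.toReal_ofReal (gaussDensity_pos a _).le]

theorem integrable_complexGaussian_iff (a : Fin n → ℂ) (f : (Fin n → ℂ) → V) :
    Integrable f (complexGaussian a) ↔ Integrable (fun y => gaussDensity a y • f y) := by
  unfold complexGaussian
  rw [integrable_withDensity_iff_integrable_smul'
    (continuous_gaussDensity a).measurable.ennreal_ofReal (by simp)]
  simp [ENNReal.toReal_ofReal (gaussDensity_pos a _).le]

end Change

theorem gaussDensity_eq_prod {n : ℕ} (a y : Fin n → ℂ) :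
    gaussDensity a y = ∏ i, Real.pi⁻¹ * Real.exp (-‖y i - a i‖ ^ 2) := by
  rw [Finset.prod_mul_distrib, ← Real.exp_sum, Finset.sum_neg_distrib]
  simp [gaussDensity]

/-- Translation to mean zero followed by Fubini. Total mass, mean and covariance all come from
particular choices of the factors `f i`. -/
theorem integral_complexGaussian_prod {n : ℕ} (a : Fin n → ℂ) (f : Fin n → ℂ → ℂ) :
    ∫ y, ∏ i, f i (y i - a i) ∂complexGaussian a
      = ∏ i, ∫ z : ℂ, ((Real.pi⁻¹ * Real.exp (-‖z‖ ^ 2) : ℝ) : ℂ) * f i z := by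
  rw [integral_complexGaussian, ← integral_fintype_prod_volume_eq_prod]
  rw [← integral_sub_right_eq_self
    (fun y : Fin n → ℂ => ∏ i, ((Real.pi⁻¹ * Real.exp (-‖y i‖ ^ 2) : ℝ) : ℂ) * f i (y i)) a]
  congr 1
  funext y
  rw [gaussDensity_eq_prod, Complex.real_smul, Complex.ofReal_prod, ← Finset.prod_mul_distrib]
  rfl

theorem integrable_exp_neg_mul_norm_sq {b : ℝ} (hb : 0 < b) :
    Integrable fun z : ℂ => Real.exp (-b * ‖z‖ ^ 2) := by
  refine Integrable.of_integral_ne_zero ?_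
  have h := Complex.integral_exp_neg_mul_rpow (p := 2) (by norm_num) hb
  simp only [Real.rpow_two] at h
  rw [h]
  have : (0:ℝ) < Real.Gamma (2 / 2 + 1) := Real.Gamma_pos_of_pos (by norm_num)
  positivity

theorem integrable_exp_mul_norm_sub_norm_sq (c : ℝ) :
    Integrable fun z : ℂ => Real.exp (c * ‖z‖ - ‖z‖ ^ 2) := by
  refine ((integrable_exp_neg_mul_norm_sq (b := 1 / 2) (by norm_num)).const_mul
    (Real.exp (c ^ 2 / 2))).mono' (by fun_prop) (.of_forall fun z => ?_)
  rw [Real.norm_of_nonneg (Real.exp_pos _).le, ← Real.exp_add]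
  gcongr
  nlinarith [sq_nonneg (c - ‖z‖)]

/-- Gaussian tails beat every exponential of the norms. This dominates the noise moments and the
derivative of the likelihood ratio. -/
theorem integrable_exp_mul_sum_norm {n : ℕ} (a : Fin n → ℂ) (c : ℝ) :
    Integrable (fun y => Real.exp (c * ∑ i, ‖y i - a i‖)) (complexGaussian a) := by
  rw [integrable_complexGaussian_iff]
  have h : Integrable fun y : Fin n → ℂ =>
      ∏ i, Real.pi⁻¹ * Real.exp (c * ‖y i‖ - ‖y i‖ ^ 2) :=
    Integrable.fintype_prod fun _ => (integrable_exp_mul_norm_sub_norm_sq c).const_mul _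
  refine (h.comp_sub_right a).congr (.of_forall fun y => ?_)
  simp only [gaussDensity_eq_prod, smul_eq_mul, Finset.mul_sum, Real.exp_sum,
    ← Finset.prod_mul_distrib, mul_assoc, ← Real.exp_add, Pi.sub_apply]
  congr! 3
  ring

theorem integral_gaussian_one : ∫ z : ℂ, ((Real.pi⁻¹ * Real.exp (-‖z‖ ^ 2) : ℝ) : ℂ) = 1 := by
  have h := Complex.integral_exp_neg_rpow (p := 2) (by norm_num)
  simp only [Real.rpow_two] at h
  rw [integral_complex_ofReal, integral_const_mul, h]
  norm_num [Real.pi_ne_zero, Real.Gamma_two]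

instance isProbabilityMeasure_complexGaussian {n : ℕ} (a : Fin n → ℂ) :
    IsProbabilityMeasure (complexGaussian a) := by
  have hint := integrable_exp_mul_sum_norm a 0
  simp only [zero_mul, Real.exp_zero, integrable_const_iff, one_ne_zero, false_or] at hint
  have h := integral_complexGaussian_prod a fun _ _ => (1 : ℂ)
  simp only [mul_one, integral_gaussian_one, Finset.prod_const_one, integral_const, Complex.real_smul] at h
  norm_cast at h
  refine ⟨?_⟩
  rw [← ENNReal.toReal_eq_one_iff]
  exact h

theorem integral_gaussian_mul_self :
    ∫ z : ℂ, ((Real.pi⁻¹ * Real.exp (-‖z‖ ^ 2) : ℝ) : ℂ) * z = 0 := by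
  have h := integral_neg_eq_self
    (fun z : ℂ => ((Real.pi⁻¹ * Real.exp (-‖z‖ ^ 2) : ℝ) : ℂ) * z) volume
  simp only [norm_neg, mul_neg, integral_neg] at h
  exact self_eq_neg.mp h.symm

theorem integral_gaussian_mul_normSq :
    ∫ z : ℂ, ((Real.pi⁻¹ * Real.exp (-‖z‖ ^ 2) : ℝ) : ℂ) * (z * star z) = 1 := by
  have h := Complex.integral_rpow_mul_exp_neg_rpow (p := 2) (q := 2) (by norm_num) (by norm_num)
  simp only [Real.rpow_two] at h
  have h2 : ∀ z : ℂ, ((Real.pi⁻¹ * Real.exp (-‖z‖ ^ 2) : ℝ) : ℂ) * (z * star z)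
      = ((Real.pi⁻¹ * (‖z‖ ^ 2 * Real.exp (-‖z‖ ^ 2)) : ℝ) : ℂ) := fun z => by
    rw [Complex.star_def, Complex.mul_conj']
    push_cast
    ring
  simp only [h2]
  rw [integral_complex_ofReal, integral_const_mul, h]
  norm_num [Real.pi_ne_zero, Real.Gamma_two]

theorem integral_complexGaussian_sub {n : ℕ} (a : Fin n → ℂ) (i : Fin n) :
    ∫ y, (y i - a i) ∂complexGaussian a = 0 := by
  have h := integral_complexGaussian_prod a fun k z => if k = i then z else 1
  simp only [Finset.prod_ite_eq', Finset.mem_univ, if_true] at h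
  rw [h]
  refine Finset.prod_eq_zero (Finset.mem_univ i) ?_
  simpa using integral_gaussian_mul_self

theorem integral_complexGaussian_sub_mul_star {n : ℕ} (a : Fin n → ℂ) (i j : Fin n) :
    ∫ y, (y i - a i) * star (y j - a j) ∂complexGaussian a = if i = j then 1 else 0 := by
  have h := integral_complexGaussian_prod a fun k z =>
    (if k = i then z else 1) * (if k = j then star z else 1)
  simp only [Finset.prod_mul_distrib, Finset.prod_ite_eq', Finset.mem_univ, if_true] at h
  rw [h]
  split_ifs with hij
  · subst hij
    refine Finset.prod_eq_one fun k _ => ?_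
    by_cases hk : k = i
    · simpa [hk] using integral_gaussian_mul_normSq
    · simpa [hk] using integral_gaussian_one
  · refine Finset.prod_eq_zero (Finset.mem_univ i) ?_
    simpa [hij] using integral_gaussian_mul_self

theorem memLp_exp_mul_sum_norm {n : ℕ} (a : Fin n → ℂ) (c : ℝ) :
    MemLp (fun y => Real.exp (c * ∑ i, ‖y i - a i‖)) 2 (complexGaussian a) := by
  rw [memLp_two_iff_integrable_sq (Continuous.aestronglyMeasurable (by fun_prop))]
  refine (integrable_exp_mul_sum_norm a (2 * c)).congr (.of_forall fun y => ?_)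
  simp only [← Real.exp_nat_mul]
  push_cast
  ring_nf

theorem memLp_sub_apply {n : ℕ} (a : Fin n → ℂ) (i : Fin n) :
    MemLp (fun y => y i - a i) 2 (complexGaussian a) := by
  refine (memLp_exp_mul_sum_norm a 1).mono
    (Continuous.aestronglyMeasurable (by fun_prop)) (.of_forall fun y => ?_)
  rw [Real.norm_of_nonneg (Real.exp_pos _).le, one_mul]
  have h := Finset.single_le_sum (f := fun i => ‖y i - a i‖) (fun _ _ => norm_nonneg _)
    (Finset.mem_univ i)
  exact h.trans ((Real.add_one_le_exp _).trans' (by linarith))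

/-! ### Differentiating the mean of a statistic in the location parameter. -/

section Derivative

variable {n : ℕ}

/-- The real-linear form `b ↦ 2 Re ∑ conj (u i) * b i`. -/
def twiceReInner (u : Fin n → ℂ) : (Fin n → ℂ) →L[ℝ] ℝ :=
  ∑ i, (2 : ℝ) • (innerSL ℝ (u i)).comp (ContinuousLinearMap.proj i)

theorem twiceReInner_apply (u b : Fin n → ℂ) :
    twiceReInner u b = 2 * (∑ i, star (u i) * b i).re := by
  simp [twiceReInner, Finset.mul_sum, Complex.inner]
  congr! 2
  ring

theorem norm_twiceReInner_le (u : Fin n → ℂ) : ‖twiceReInner u‖ ≤ 2 * ∑ i, ‖u i‖ := by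
  refine ContinuousLinearMap.opNorm_le_bound _ (by positivity) fun b => ?_
  rw [twiceReInner_apply, norm_mul, Real.norm_two, mul_assoc]
  gcongr
  refine (Complex.abs_re_le_norm _).trans ((norm_sum_le _ _).trans ?_)
  rw [Finset.sum_mul]
  gcongr with i
  rw [norm_mul, norm_star]
  gcongr
  exact norm_le_pi_norm b i

theorem continuous_twiceReInner : Continuous (twiceReInner : (Fin n → ℂ) → _) := by
  unfold twiceReInner
  fun_prop

theorem hasFDerivAt_sum_norm_sq (y a : Fin n → ℂ) :
    HasFDerivAt (fun a : Fin n → ℂ => ∑ i, ‖y i - a i‖ ^ 2) (-twiceReInner (y - a)) a := by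
  have h : ∀ i ∈ Finset.univ, HasFDerivAt (fun a : Fin n → ℂ => ‖y i - a i‖ ^ 2)
      (-((2 : ℝ) • (innerSL ℝ ((y - a) i)).comp (ContinuousLinearMap.proj i))) a := fun i _ => by
    have h1 : HasFDerivAt (fun a : Fin n → ℂ => y i - a i)
        (-(ContinuousLinearMap.proj i : (Fin n → ℂ) →L[ℝ] ℂ)) a :=
      (ContinuousLinearMap.proj (R := ℝ) (φ := fun _ : Fin n => ℂ) i).hasFDerivAt.const_sub _
    convert! h1.norm_sq using 1
    ext b
    simp
    ring
  convert! HasFDerivAt.fun_sum h using 1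
  simp [twiceReInner]

/-- The growth is only linear in `‖u‖`, so for shifts of size at most `1` the likelihood ratio is at
most an exponential of the sum of the norms. -/
theorem norm_sq_sub_norm_sq_le {u b : ℂ} (hb : ‖b‖ ≤ 1) : ‖u‖ ^ 2 - ‖u - b‖ ^ 2 ≤ 2 * ‖u‖ := by
  have h1 : ‖u‖ ≤ ‖u - b‖ + 1 := by
    have := norm_sub_norm_le u (u - b)
    simp only [sub_sub_cancel] at this
    linarith
  nlinarith [norm_nonneg u, norm_nonneg (u - b), sq_nonneg (‖u‖ - ‖u - b‖)]

theorem gaussDensity_eq_mul (a₀ a y : Fin n → ℂ) : gaussDensity a y = gaussDensity a₀ y *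
    Real.exp (∑ i, ‖y i - a₀ i‖ ^ 2 - ∑ i, ‖y i - a i‖ ^ 2) := by
  unfold gaussDensity
  rw [mul_assoc, ← Real.exp_add]
  congr 2
  ring

variable {V : Type*} [NormedAddCommGroup V] [NormedSpace ℝ V]

/-- Moving the parameter from the law into a likelihood ratio against the fixed law at `a₀` allows
differentiation under the integral, with moments of `g` assumed at `a₀` only. -/
theorem hasFDerivAt_integral_complexGaussian {g : (Fin n → ℂ) → V} {a₀ : Fin n → ℂ}
    (hg : MemLp g 2 (complexGaussian a₀)) :
    HasFDerivAt (fun a => ∫ y, g y ∂complexGaussian a)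
      (∫ y, (twiceReInner (y - a₀)).smulRight (g y) ∂complexGaussian a₀) a₀ ∧
    Integrable (fun y => (twiceReInner (y - a₀)).smulRight (g y)) (complexGaussian a₀) := by
  set ratio : (Fin n → ℂ) → (Fin n → ℂ) → ℝ := fun a y =>
    Real.exp (∑ i, ‖y i - a₀ i‖ ^ 2 - ∑ i, ‖y i - a i‖ ^ 2) with hratio
  have hcont : ∀ a, Continuous (ratio a) := fun a => by
    rw [hratio]
    fun_prop
  have heq : ∀ a, ∫ y, g y ∂complexGaussian a = ∫ y, ratio a y • g y ∂complexGaussian a₀ :=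
    fun a => by
      simp only [integral_complexGaussian, smul_smul, gaussDensity_eq_mul a₀ a, hratio]
  have hone : ∀ y, ratio a₀ y = 1 := fun y => by simp [hratio]
  set F' : (Fin n → ℂ) → (Fin n → ℂ) → (Fin n → ℂ) →L[ℝ] V := fun a y =>
    (ratio a y • twiceReInner (y - a)).smulRight (g y) with hF'
  -- With `S = ∑ ‖y i - a₀ i‖`, the ratio contributes `exp (2 S)` and the linear form `2 (S + n) ≤ 2
  -- (n + 1) exp S`. Both the exponential and `g` are square-integrable, so their product is
  -- integrable.
  set bound : (Fin n → ℂ) → ℝ := fun y =>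
    2 * (n + 1) * (Real.exp (3 * ∑ i, ‖y i - a₀ i‖) * ‖g y‖) with hbound
  have hbi : Integrable bound (complexGaussian a₀) :=
    ((memLp_exp_mul_sum_norm a₀ 3).integrable_mul hg.norm).const_mul _
  have hmeas : AEStronglyMeasurable (F' a₀) (complexGaussian a₀) := by
    have h1 : AEStronglyMeasurable (fun y => ratio a₀ y • twiceReInner (y - a₀))
        (complexGaussian a₀) := by
      have := continuous_twiceReInner (n := n)
      exact ((hcont a₀).smul (this.comp (by fun_prop))).aestronglyMeasurable
    exact (ContinuousLinearMap.smulRightL ℝ (Fin n → ℂ) V).aestronglyMeasurable_comp₂ h1 hg.1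
  have hle : ∀ y, ∀ a ∈ Metric.ball a₀ 1, ‖F' a y‖ ≤ bound y := fun y a ha => by
    have hd : ∀ i, ‖a i - a₀ i‖ ≤ 1 := fun i =>
      (norm_le_pi_norm (a - a₀) i).trans (mem_ball_iff_norm.mp ha).le
    set S := ∑ i, ‖y i - a₀ i‖ with hS
    have hS0 : 0 ≤ S := by positivity
    have h1 : ratio a y ≤ Real.exp (2 * S) := by
      rw [hratio]
      refine Real.exp_le_exp.mpr ?_
      rw [← Finset.sum_sub_distrib, Finset.mul_sum]
      gcongr with i
      convert! norm_sq_sub_norm_sq_le (u := y i - a₀ i) (hd i) using 4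
      ring
    have h2 : ∑ i, ‖(y - a) i‖ ≤ S + n := by
      have : ∑ i, ‖(y - a) i‖ ≤ ∑ i, (‖y i - a₀ i‖ + 1) := by
        gcongr with i
        have := norm_sub_le (y i - a₀ i) (a i - a₀ i)
        simp only [sub_sub_sub_cancel_right] at this
        exact this.trans (by linarith [hd i])
      simpa [Finset.sum_add_distrib] using this
    have h3 : S + n ≤ (n + 1) * Real.exp S := by
      have h4 := Real.add_one_le_exp S
      have hn : (0 : ℝ) ≤ n := by positivity
      nlinarith
    have h5 : ‖twiceReInner (y - a)‖ ≤ 2 * ((n + 1) * Real.exp S) :=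
      (norm_twiceReInner_le _).trans (by linarith)
    have h6 : 0 < ratio a y := Real.exp_pos _
    calc ‖F' a y‖ = ratio a y * ‖twiceReInner (y - a)‖ * ‖g y‖ := by
          rw [hF', ContinuousLinearMap.norm_smulRight_apply, norm_smul,
            Real.norm_of_nonneg h6.le]
      _ ≤ Real.exp (2 * S) * (2 * ((n + 1) * Real.exp S)) * ‖g y‖ := by gcongr
      _ = bound y := by
          have : Real.exp (3 * S) = Real.exp (2 * S) * Real.exp S := by
            rw [← Real.exp_add]
            ring_nf
          rw [hbound]
          simp only [← hS, this]
          ring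
  have hsimp : F' a₀ = fun y => (twiceReInner (y - a₀)).smulRight (g y) := by
    funext y
    simp [hF', hone]
  have hFint : Integrable (F' a₀) (complexGaussian a₀) :=
    hbi.mono' hmeas (.of_forall fun y => hle y a₀ (Metric.mem_ball_self one_pos))
  rw [← hsimp]
  refine ⟨?_, hFint⟩
  simp only [heq]
  refine hasFDerivAt_integral_of_dominated_of_fderiv_le (bound := bound)
    (Metric.ball_mem_nhds a₀ one_pos)
    (.of_forall fun a => (hcont a).aestronglyMeasurable.smul hg.1) ?_ hmeas
    (.of_forall hle) hbi (.of_forall fun y a _ => ?_)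
  · exact (hg.integrable one_le_two).congr (.of_forall fun y => by simp [hone])
  · have h := ((hasFDerivAt_sum_norm_sq y a).const_sub (∑ i, ‖y i - a₀ i‖ ^ 2)).exp
    rw [neg_neg] at h
    exact h.smul_const (g y)

end Derivative

/-! ### Second-moment matrices and the abstract Cramér-Rao inequality. -/

section Moments

variable {Ω ι κ : Type} [MeasurableSpace Ω] {μ : Measure Ω}

/-- The matrix `E[u wᴴ]` of mixed second moments. -/
def crossMoment (μ : Measure Ω) (u : Ω → ι → ℂ) (w : Ω → κ → ℂ) : Matrix ι κ ℂ :=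
  Matrix.of fun k l => ∫ y, u y k * star (w y l) ∂μ

theorem integrable_mul_star {f g : Ω → ℂ} (hf : MemLp f 2 μ) (hg : MemLp g 2 μ) :
    Integrable (fun y => f y * star (g y)) μ :=
  hf.integrable_mul hg.star

theorem conjTranspose_crossMoment (u : Ω → ι → ℂ) (w : Ω → κ → ℂ) :
    (crossMoment μ u w)ᴴ = crossMoment μ w u := by
  ext k l
  simp only [conjTranspose_apply, crossMoment, of_apply, Complex.star_def, ← integral_conj]
  congr! 2
  simp [mul_comm]

theorem crossMoment_sub_left {u u' : Ω → ι → ℂ} {w : Ω → κ → ℂ}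
    (hu : ∀ k, MemLp (fun y => u y k) 2 μ) (hu' : ∀ k, MemLp (fun y => u' y k) 2 μ)
    (hw : ∀ k, MemLp (fun y => w y k) 2 μ) :
    crossMoment μ (fun y => u y - u' y) w = crossMoment μ u w - crossMoment μ u' w := by
  ext k l
  simp only [crossMoment, of_apply, Matrix.sub_apply, Pi.sub_apply, sub_mul]
  exact integral_sub (integrable_mul_star (hu k) (hw l)) (integrable_mul_star (hu' k) (hw l))

theorem memLp_mulVec [Fintype κ] (A : Matrix ι κ ℂ) {u : Ω → κ → ℂ}
    (hu : ∀ k, MemLp (fun y => u y k) 2 μ) (i : ι) : MemLp (fun y => (A *ᵥ u y) i) 2 μ :=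
  memLp_finsetSum _ fun k _ => (hu k).const_mul (A i k)

theorem crossMoment_mulVec_left {κ' : Type} [Fintype κ] (A : Matrix ι κ ℂ) {u : Ω → κ → ℂ}
    {w : Ω → κ' → ℂ} (hu : ∀ k, MemLp (fun y => u y k) 2 μ)
    (hw : ∀ k, MemLp (fun y => w y k) 2 μ) :
    crossMoment μ (fun y => A *ᵥ u y) w = A * crossMoment μ u w := by
  ext k l
  simp only [crossMoment, of_apply, mul_apply, mulVec, dotProduct, Finset.sum_mul, mul_assoc]
  rw [integral_finsetSum _ fun i _ => (integrable_mul_star (hu i) (hw l)).const_mul _]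
  simp only [integral_const_mul]

theorem crossMoment_mulVec_right {κ' : Type} [Fintype κ] (A : Matrix ι κ ℂ) {u : Ω → κ → ℂ}
    {w : Ω → κ' → ℂ} (hu : ∀ k, MemLp (fun y => u y k) 2 μ)
    (hw : ∀ k, MemLp (fun y => w y k) 2 μ) :
    crossMoment μ w (fun y => A *ᵥ u y) = crossMoment μ w u * Aᴴ := by
  rw [← conjTranspose_crossMoment, crossMoment_mulVec_left A hu hw, conjTranspose_mul,
    conjTranspose_crossMoment]

/-- The quadratic form at `x` is `E|xᴴ u|²`. -/
theorem posSemidef_crossMoment [Fintype ι] {u : Ω → ι → ℂ}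
    (hu : ∀ k, MemLp (fun y => u y k) 2 μ) : (crossMoment μ u u).PosSemidef := by
  refine .of_dotProduct_mulVec_nonneg (conjTranspose_crossMoment u u) fun x => ?_
  have h : star x ⬝ᵥ crossMoment μ u u *ᵥ x
      = ∫ y, ((‖∑ k, star (x k) * u y k‖ ^ 2 : ℝ) : ℂ) ∂μ := by
    have hi : ∀ k l, Integrable (fun y => star (x k) * (u y k * star (u y l) * x l)) μ :=
      fun k l => ((integrable_mul_star (hu k) (hu l)).mul_const _).const_mul _
    have h1 : ∀ y, ((‖∑ k, star (x k) * u y k‖ ^ 2 : ℝ) : ℂ)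
        = ∑ k, ∑ l, star (x k) * (u y k * star (u y l) * x l) := fun y => by
      rw [Complex.ofReal_pow, ← Complex.mul_conj', map_sum, Finset.sum_mul_sum]
      congr! 2
      simp
      ring
    simp only [h1]
    rw [integral_finsetSum _ fun k _ => integrable_finsetSum _ fun l _ => hi k l]
    simp only [dotProduct, mulVec, Finset.mul_sum, Pi.star_apply]
    congr! 1 with k
    rw [integral_finsetSum _ fun l _ => hi k l]
    simp only [integral_const_mul, integral_mul_const, crossMoment, of_apply]
  rw [h, integral_complex_ofReal]
  exact_mod_cast integral_nonneg fun y => sq_nonneg _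

/-- The constrained Cramér-Rao inequality for an error `e` and a score `v` with
`E[e vᴴ] E = E`. -/
theorem posSemidef_crossMoment_sub [Fintype ι] [Fintype κ] [DecidableEq κ] {e v : Ω → ι → ℂ}
    (he : ∀ k, MemLp (fun y => e y k) 2 μ) (hv : ∀ k, MemLp (fun y => v y k) 2 μ)
    {E : Matrix ι κ ℂ} (hE : crossMoment μ e v * E = E)
    (hunit : IsUnit (Eᴴ * crossMoment μ v v * E)) :
    (crossMoment μ e e - E * (Eᴴ * crossMoment μ v v * E)⁻¹ * Eᴴ).PosSemidef := by
  set J := crossMoment μ v v with hJ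
  set G := Eᴴ * J * E with hG
  have hGH : Gᴴ = G := by
    rw [hG, conjTranspose_mul, conjTranspose_mul, conjTranspose_conjTranspose, hJ,
      conjTranspose_crossMoment, Matrix.mul_assoc]
  set B := E * G⁻¹ * Eᴴ with hB
  have hBH : Bᴴ = B := by
    rw [hB, conjTranspose_mul, conjTranspose_mul, conjTranspose_conjTranspose,
      conjTranspose_nonsing_inv, hGH, Matrix.mul_assoc]
  have hBv := memLp_mulVec B hv
  have hw : ∀ k, MemLp (fun y => (e y - B *ᵥ v y) k) 2 μ := fun k => (he k).sub (hBv k)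
  have hev : crossMoment μ e v * B = B := by
    rw [hB, ← Matrix.mul_assoc, ← Matrix.mul_assoc, hE]
  have hve : B * crossMoment μ v e = B := by
    rw [← conjTranspose_crossMoment, ← hBH, ← conjTranspose_mul, hev]
  have hBJB : B * J * B = B := by
    have h1 : B * J * B = E * (G⁻¹ * (Eᴴ * J * E)) * G⁻¹ * Eᴴ := by
      simp only [hB, Matrix.mul_assoc]
    rw [h1, ← hG, nonsing_inv_mul _ ((isUnit_iff_isUnit_det _).mp hunit), Matrix.mul_one]
  -- All three terms other than `E[e eᴴ]` equal `B` up to sign: the two cross terms since `E[e vᴴ] B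
  -- = B`, the last since `B J B = B`.
  have key : crossMoment μ (fun y => e y - B *ᵥ v y) (fun y => e y - B *ᵥ v y)
      = crossMoment μ e e - B := by
    rw [crossMoment_sub_left he hBv hw, crossMoment_mulVec_left B hv hw,
      ← conjTranspose_crossMoment _ e, ← conjTranspose_crossMoment _ v,
      crossMoment_sub_left he hBv he, crossMoment_sub_left he hBv hv,
      crossMoment_mulVec_left B hv he, crossMoment_mulVec_left B hv hv, hve, conjTranspose_sub,
      conjTranspose_sub, conjTranspose_crossMoment, conjTranspose_crossMoment, hBH,
      conjTranspose_mul, conjTranspose_crossMoment, hBH, Matrix.mul_sub, hve, ← hJ,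
      ← Matrix.mul_assoc, hBJB]
    abel
  rw [← key]
  exact posSemidef_crossMoment hw

end Moments

/-! ### The convolution model: Jacobian, score and Fisher information. -/

section Model

variable {L K : ℕ}

/-- The condition `a + j = i` avoids truncated subtraction and treats `v` and `w` symmetrically, so
that `𝒯_x h` and `𝒯_h x` become comparable. -/
theorem toeplitz_mulVec {r n m : ℕ} (v : Fin m → ℂ) (w : Fin n → ℂ) (i : Fin r) :
    (toeplitz r n v *ᵥ w) i
      = ∑ j : Fin n, ∑ a : Fin m, if a.val + j.val = i.val then v a * w j else 0 := by
  simp only [mulVec, dotProduct, toeplitz, of_apply]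
  congr! 1 with j
  split_ifs with h
  · rw [Finset.sum_eq_single ⟨i.val - j.val, h.2⟩]
    · rw [if_pos (by simp only; omega)]
    · intro a _ ha
      rw [if_neg]
      rintro h'
      exact ha (Fin.ext (by simp only; omega))
    · simp
  · rw [zero_mul, Finset.sum_eq_zero]
    intro a _
    rw [if_neg]
    have := a.isLt
    omega

/-- The Jacobian `√γ [𝒯_x 𝒯_h]` of the noiseless received signal. -/
def signalJacobian (γ : ℝ) (θ : Idx L K → ℂ) : Matrix (Fin (K + L)) (Idx L K) ℂ :=
  (Real.sqrt γ : ℂ) • toeplitzPair θ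

/-- The product rule for the bilinear convolution gives `𝒯_x δh + 𝒯_h δx`. Scalars are restricted to
`ℝ` because the Gaussian density is only real-differentiable in its mean. -/
theorem hasFDerivAt_signal (γ : ℝ) (θ : Idx L K → ℂ) :
    HasFDerivAt (signal γ)
      ((signalJacobian γ θ).mulVecLin.toContinuousLinearMap.restrictScalars ℝ) θ := by
  rw [hasFDerivAt_pi']
  intro i
  have hterm : ∀ (j : Fin K) (a : Fin (L + 1)), HasFDerivAt
      (fun θ : Idx L K → ℂ => if a.val + j.val = i.val then chan θ a * inp θ j else 0)
      (if a.val + j.val = i.val then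
        θ (Sum.inl a) • (ContinuousLinearMap.proj (R := ℝ) (φ := fun _ : Idx L K => ℂ) (Sum.inr j))
        + θ (Sum.inr j) •
          (ContinuousLinearMap.proj (R := ℝ) (φ := fun _ : Idx L K => ℂ) (Sum.inl a))
        else 0) θ := fun j a => by
    split_ifs
    · exact (ContinuousLinearMap.proj (R := ℝ) (φ := fun _ : Idx L K => ℂ)
        (Sum.inl a)).hasFDerivAt.mul (ContinuousLinearMap.proj (R := ℝ)
        (φ := fun _ : Idx L K => ℂ) (Sum.inr j)).hasFDerivAt
    · exact hasFDerivAt_const _ _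
  have hsum := (HasFDerivAt.fun_sum (u := Finset.univ) fun j _ =>
    HasFDerivAt.fun_sum (u := Finset.univ) fun a _ => hterm j a).const_mul (Real.sqrt γ : ℂ)
  simp only [signal, Pi.smul_apply, smul_eq_mul, toeplitz_mulVec]
  convert! hsum using 1
  ext δ
  have hδ : (toeplitzPair θ *ᵥ δ) i = ∑ j : Fin K, ∑ a : Fin (L + 1),
      if a.val + j.val = i.val then θ (Sum.inl a) * δ (Sum.inr j) + θ (Sum.inr j) * δ (Sum.inl a)
        else 0 := by
    rw [toeplitzPair, fromCols_mulVec, Pi.add_apply, toeplitz_mulVec, toeplitz_mulVec,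
      Finset.sum_comm, ← Finset.sum_add_distrib]
    congr! 1 with j
    rw [← Finset.sum_add_distrib]
    congr! 1 with a
    rw [Nat.add_comm j.val]
    split_ifs
    · simp only [chan, inp, Function.comp_apply]
      ring
    · simp
  simp only [ContinuousLinearMap.comp_apply, ContinuousLinearMap.coe_restrictScalars',
    LinearMap.coe_toContinuousLinearMap', mulVecLin_apply, ContinuousLinearMap.proj_apply,
    signalJacobian, smul_mulVec, Pi.smul_apply, hδ, _root_.smul_apply,
    _root_.sum_apply, smul_eq_mul]
  congr! 3
  split_ifs <;> simp

theorem hasFDerivAt_log_gaussDensity {n : ℕ} (y a : Fin n → ℂ) :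
    HasFDerivAt (fun a => Real.log (gaussDensity a y)) (twiceReInner (y - a)) a := by
  have h : (fun a => Real.log (gaussDensity a y))
      = fun a => Real.log (Real.pi ^ n)⁻¹ - ∑ i, ‖y i - a i‖ ^ 2 := by
    funext a
    rw [gaussDensity, Real.log_mul (by positivity) (by positivity), Real.log_exp, sub_eq_add_neg]
  rw [h]
  simpa using (hasFDerivAt_sum_norm_sq y a).const_sub (Real.log (Real.pi ^ n)⁻¹)

theorem score_eq (γ : ℝ) (θ : Idx L K → ℂ) (y : Fin (K + L) → ℂ) :
    score γ θ y = (signalJacobian γ θ)ᴴ *ᵥ (y - signal γ θ) := by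
  have h := Complex.ofRealCLM.hasFDerivAt.comp θ
    ((hasFDerivAt_log_gaussDensity y (signal γ θ)).comp θ (hasFDerivAt_signal γ θ))
  funext k
  have hf : (fun θ' : Idx L K → ℂ => (Real.log (pdf γ θ' y) : ℂ))
      = Complex.ofRealCLM ∘ (fun a => Real.log (gaussDensity a y)) ∘ signal γ := rfl
  have hs : ∀ c : ℂ, ∑ i, star ((y - signal γ θ) i) * (signalJacobian γ θ *ᵥ Pi.single k c) i
      = star (((signalJacobian γ θ)ᴴ *ᵥ (y - signal γ θ)) k) * c := fun c => by
    have hc : ∀ i, (signalJacobian γ θ *ᵥ Pi.single k c) i = signalJacobian γ θ i k * c :=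
      fun i => by simp [mulVec_single]
    simp only [hc]
    simp only [mulVec, dotProduct, star_sum, Finset.sum_mul, star_mul', conjTranspose_apply,
      star_star]
    congr! 1 with i
    ring
  simp only [score, wirtingerConj, hf, h.fderiv, ContinuousLinearMap.comp_apply,
    ContinuousLinearMap.coe_restrictScalars', LinearMap.coe_toContinuousLinearMap',
    mulVecLin_apply, twiceReInner_apply, hs, Complex.ofRealCLM_apply]
  generalize ((signalJacobian γ θ)ᴴ *ᵥ (y - signal γ θ)) k = z
  -- The real derivative is `c ↦ 2 Re (z̄ c)`; its values at `1` and `i` are `2 Re z` and `2 Im z`,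
  -- which the Wirtinger combination reassembles into `z`.
  apply Complex.ext <;> simp

theorem memLp_sub_signal (γ : ℝ) (θ : Idx L K → ℂ) (i : Fin (K + L)) :
    MemLp (fun y => (y - signal γ θ) i) 2 (law γ θ) := memLp_sub_apply _ i

theorem crossMoment_noise (γ : ℝ) (θ : Idx L K → ℂ) :
    crossMoment (law γ θ) (fun y => y - signal γ θ) (fun y => y - signal γ θ) = 1 := by
  ext i j
  rw [one_apply, ← integral_complexGaussian_sub_mul_star (signal γ θ)]
  rfl

theorem crossMoment_score (γ : ℝ) (θ : Idx L K → ℂ) :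
    crossMoment (law γ θ) (score γ θ) (score γ θ)
      = (signalJacobian γ θ)ᴴ * signalJacobian γ θ := by
  have hu := memLp_sub_signal γ θ
  have hs : score γ θ = fun y => (signalJacobian γ θ)ᴴ *ᵥ (y - signal γ θ) :=
    funext (score_eq γ θ)
  rw [hs, crossMoment_mulVec_left _ hu (memLp_mulVec _ hu), crossMoment_mulVec_right _ hu hu,
    crossMoment_noise, conjTranspose_conjTranspose, Matrix.one_mul]

theorem signalJacobian_gram {γ : ℝ} (hγ : 0 ≤ γ) (θ : Idx L K → ℂ) :
    (signalJacobian γ θ)ᴴ * signalJacobian γ θ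
      = (γ : ℂ) • ((toeplitzPair θ)ᴴ * toeplitzPair θ) := by
  rw [signalJacobian, conjTranspose_smul, Matrix.smul_mul, Matrix.mul_smul, smul_smul, Complex.star_def,
    Complex.conj_ofReal, ← Complex.ofReal_mul, Real.mul_self_sqrt hγ]

theorem IsUnbiased.isUnbiasedToFirstOrder {γ : ℝ} {Θ : Set (Idx L K → ℂ)} {θ : Idx L K → ℂ}
    {est : (Fin (K + L) → ℂ) → Idx L K → ℂ} (h : IsUnbiased γ Θ est) (hθ : θ ∈ Θ) :
    IsUnbiasedToFirstOrder γ Θ θ est :=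
  ⟨(h θ hθ).2, (hasFDerivWithinAt_id θ Θ).congr (fun θ' hθ' => (h θ' hθ').2) (h θ hθ).2⟩

/-- If `θ + t δ` stays in the parameter space, then differentiating the mean of the estimator in the
direction `δ` yields `δ`. -/
theorem integral_twiceReInner_mul {γ : ℝ} {Θ : Set (Idx L K → ℂ)} {θ δ : Idx L K → ℂ}
    {est : (Fin (K + L) → ℂ) → Idx L K → ℂ} (hest : MemLp est 2 (law γ θ))
    (hunb : IsUnbiasedToFirstOrder γ Θ θ est) (hδ : ∀ t : ℝ, θ + t • δ ∈ Θ) (k : Idx L K) :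
    Integrable (fun y => (twiceReInner (y - signal γ θ) (signalJacobian γ θ *ᵥ δ) : ℂ) * est y k)
      (law γ θ) ∧
    ∫ y, (twiceReInner (y - signal γ θ) (signalJacobian γ θ *ᵥ δ) : ℂ) * est y k ∂law γ θ
      = δ k := by
  obtain ⟨hG, hint⟩ := hasFDerivAt_integral_complexGaussian (a₀ := signal γ θ) hest
  have hline : HasDerivAt (fun t : ℝ => θ + t • δ) δ 0 := by
    simpa using ((hasDerivAt_id (0 : ℝ)).smul_const δ).const_add θ
  have h0 : θ + (0 : ℝ) • δ = θ := by simp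
  have h1 := hunb.2.comp_hasDerivAt_of_eq 0 hline (.of_forall hδ) h0.symm
  -- Unbiasedness gives a derivative only within `Θ`; on a line contained in `Θ` it is an ordinary
  -- one, comparable with the chain rule through the Gaussian mean.
  have h3 := h1.unique ((hG.comp θ (hasFDerivAt_signal γ θ)).comp_hasDerivAt_of_eq 0 hline h0.symm)
  have hint' := hint.apply_continuousLinearMap (signalJacobian γ θ *ᵥ δ)
  have h4 : δ = ∫ y, twiceReInner (y - signal γ θ) (signalJacobian γ θ *ᵥ δ) • est y ∂law γ θ := by
    refine h3.trans ?_
    exact ContinuousLinearMap.integral_apply hint (signalJacobian γ θ *ᵥ δ)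
  have hcoord : ∀ y, (ContinuousLinearMap.proj (R := ℝ) (φ := fun _ : Idx L K => ℂ) k)
      (twiceReInner (y - signal γ θ) (signalJacobian γ θ *ᵥ δ) • est y)
      = (twiceReInner (y - signal γ θ) (signalJacobian γ θ *ᵥ δ) : ℂ) * est y k := fun y => by
    simp
  simp only [← hcoord]
  refine ⟨ContinuousLinearMap.integrable_comp _ hint', ?_⟩
  have h5 := ContinuousLinearMap.integral_comp_comm
    (ContinuousLinearMap.proj (R := ℝ) (φ := fun _ : Idx L K => ℂ) k) hint'
  exact h5.trans (congrFun h4.symm k)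

end Model

/-! ### Complex directions, the constraint set and invertibility. -/

variable {L K : ℕ}

/-- If `θ + z δ` stays in the parameter space for complex `z`, then `δ` is fixed by the
cross-moment of the estimator and the noise times the Jacobian. -/
theorem crossMoment_noise_mulVec {γ : ℝ} {Θ : Set (Idx L K → ℂ)} {θ δ : Idx L K → ℂ}
    {est : (Fin (K + L) → ℂ) → Idx L K → ℂ} (hest : MemLp est 2 (law γ θ))
    (hunb : IsUnbiasedToFirstOrder γ Θ θ est) (hδ : ∀ z : ℂ, θ + z • δ ∈ Θ) :
    crossMoment (law γ θ) est (fun y => y - signal γ θ) *ᵥ (signalJacobian γ θ *ᵥ δ) = δ := by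
  funext k
  have hk := memLp_pi_iff.mp hest k
  obtain ⟨hi1, h1⟩ := integral_twiceReInner_mul (δ := δ) hest hunb
    (fun t => by simpa using hδ t) k
  obtain ⟨hi2, h2⟩ := integral_twiceReInner_mul (δ := Complex.I • δ) hest hunb
    (fun t => by simpa [mul_smul] using hδ (t * Complex.I)) k
  have hsum : ∀ y, est y k * ∑ i, star ((y - signal γ θ) i) * (signalJacobian γ θ *ᵥ δ) i
      = (1 / 2) * ((twiceReInner (y - signal γ θ) (signalJacobian γ θ *ᵥ δ) : ℂ) * est y k
        - Complex.I * ((twiceReInner (y - signal γ θ) (signalJacobian γ θ *ᵥ Complex.I • δ) : ℂ)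
          * est y k)) := fun y => by
    have hI : ∑ i, star ((y - signal γ θ) i) * (signalJacobian γ θ *ᵥ Complex.I • δ) i
        = Complex.I * ∑ i, star ((y - signal γ θ) i) * (signalJacobian γ θ *ᵥ δ) i := by
      rw [mulVec_smul, Finset.mul_sum]
      congr! 1 with i
      rw [Pi.smul_apply, smul_eq_mul]
      ring
    rw [twiceReInner_apply, twiceReInner_apply, hI]
    generalize ∑ i, star ((y - signal γ θ) i) * (signalJacobian γ θ *ᵥ δ) i = z
    generalize est y k = e
    -- `Re (i z) = -Im z`, so the directions `δ` and `iδ` together recover `z`; the same combination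
    -- of the two means is `(δ - i (iδ)) / 2 = δ`.
    have hz : z = (1 / 2) * (((2 * z.re : ℝ) : ℂ)
        - Complex.I * ((2 * (Complex.I * z).re : ℝ) : ℂ)) := by
      apply Complex.ext <;> simp
    nth_rewrite 1 [hz]
    ring
  have hlhs : (crossMoment (law γ θ) est (fun y => y - signal γ θ) *ᵥ
      (signalJacobian γ θ *ᵥ δ)) k = ∫ y, est y k *
        ∑ i, star ((y - signal γ θ) i) * (signalJacobian γ θ *ᵥ δ) i ∂law γ θ := by
    simp only [Finset.mul_sum, ← mul_assoc]
    rw [integral_finsetSum _ fun i _ =>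
      (integrable_mul_star hk (memLp_sub_signal γ θ i)).mul_const _]
    simp only [integral_mul_const]
    rfl
  rw [hlhs]
  simp only [hsum]
  rw [integral_const_mul, integral_sub hi1 (hi2.const_mul _), integral_const_mul, h1, h2,
    Pi.smul_apply, smul_eq_mul, ← mul_assoc, Complex.I_mul_I]
  ring

/-- `Θ` is a complex affine space: `h` is free, and `x` may move along the null space of the
constraint matrix. -/
theorem add_smul_mem_paramSpace {S r q d : ℕ} {B : Matrix (Fin K) (Fin S) ℂ}
    {U : Matrix (Fin K) (Fin r) ℂ} {A : Matrix (Fin q) (Fin S) ℂ} {c : Fin q → ℂ}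
    {θ : Idx L K → ℂ} (hθ : θ ∈ paramSpace L B U A c) {Et : Matrix (Fin K) (Fin d) ℂ}
    (hEt : constraintMatrix B U A * Et = 0) (ξ : Idx L d → ℂ) (z : ℂ) :
    θ + z • (complementMatrix L Et *ᵥ ξ) ∈ paramSpace L B U A c := by
  have h : inp (θ + z • (complementMatrix L Et *ᵥ ξ)) = inp θ + z • (Et *ᵥ (ξ ∘ Sum.inr)) := by
    funext i
    simp [inp, complementMatrix, fromBlocks_mulVec]
  simp only [paramSpace, Set.mem_ofPred_eq] at hθ ⊢
  rw [h, mulVec_add, mulVec_smul, mulVec_mulVec, hEt, zero_mulVec, smul_zero, add_zero, hθ]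

theorem complementMatrix_gram {d : ℕ} {Et : Matrix (Fin K) (Fin d) ℂ} (hEt : Etᴴ * Et = 1) :
    (complementMatrix L Et)ᴴ * complementMatrix L Et = 1 := by
  simp [complementMatrix, fromBlocks_conjTranspose, fromBlocks_multiply, hEt]

theorem fisherInfo_eq_crossMoment (γ : ℝ) (θ : Idx L K → ℂ) :
    fisherInfo γ θ = crossMoment (law γ θ) (score γ θ) (score γ θ) := rfl

/-- A left inverse makes `D E` injective, so its Gram matrix is positive definite. -/
theorem isUnit_conjTranspose_mul_mul_of_leftInverse {m n κ : Type} [Fintype m] [Fintype n]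
    [Fintype κ] [DecidableEq κ] {D : Matrix m n ℂ} {E : Matrix n κ ℂ} {T : Matrix κ m ℂ}
    (h : T * (D * E) = 1) : IsUnit (Eᴴ * (Dᴴ * D) * E) := by
  have hrw : Eᴴ * (Dᴴ * D) * E = (D * E)ᴴ * (D * E) := by
    simp only [conjTranspose_mul, Matrix.mul_assoc]
  rw [hrw]
  refine (PosDef.conjTranspose_mul_self _ ?_).isUnit
  refine Function.LeftInverse.injective (g := T.mulVec) fun x => ?_
  rw [mulVec_mulVec, h, one_mulVec]

end SemiBlind

end

theorem mainTheorem4 {M L N q r d : ℕ} (γ : ℝ) (hγ : 0 < γ)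
    (F : Matrix (Fin (M + L)) (Fin M) ℂ)
    (A : Matrix (Fin q) (Fin (N * M)) ℂ) (c : Fin q → ℂ)
    (Un : Matrix (Fin (N * (M + L))) (Fin r) ℂ)
    (hUn : SemiBlind.IsNullBasis (SemiBlind.blockPrecoder N F) Un)
    (Et : Matrix (Fin (N * (M + L))) (Fin d) ℂ)
    (hEt : Etᴴ * Et = 1)
    (hEt0 : SemiBlind.constraintMatrix (SemiBlind.blockPrecoder N F) Un A * Et = 0)
    (θ : SemiBlind.Idx L (N * (M + L)) → ℂ)
    (hθ : θ ∈ SemiBlind.paramSpace L (SemiBlind.blockPrecoder N F) Un A c) :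
    SemiBlind.fisherInfo γ θ
        = (γ : ℂ) • ((SemiBlind.toeplitzPair θ)ᴴ * SemiBlind.toeplitzPair θ) ∧
    ∀ est : (Fin (N * (M + L) + L) → ℂ) → SemiBlind.Idx L (N * (M + L)) → ℂ,
      MemLp est 2 (SemiBlind.law γ θ) →
      (SemiBlind.IsUnbiased γ
          (SemiBlind.paramSpace L (SemiBlind.blockPrecoder N F) Un A c) est ∨
        SemiBlind.IsUnbiasedToFirstOrder γ
          (SemiBlind.paramSpace L (SemiBlind.blockPrecoder N F) Un A c) θ est) →
      IsUnit ((SemiBlind.complementMatrix L Et)ᴴ * SemiBlind.fisherInfo γ θ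
          * SemiBlind.complementMatrix L Et) ∧
      (SemiBlind.cov (SemiBlind.law γ θ) est
        - SemiBlind.complementMatrix L Et
          * ((SemiBlind.complementMatrix L Et)ᴴ * SemiBlind.fisherInfo γ θ
              * SemiBlind.complementMatrix L Et)⁻¹
          * (SemiBlind.complementMatrix L Et)ᴴ).PosSemidef := by
  open SemiBlind in
  have hJ : fisherInfo γ θ = (signalJacobian γ θ)ᴴ * signalJacobian γ θ := by
    rw [fisherInfo_eq_crossMoment, crossMoment_score]
  refine ⟨hJ.trans (signalJacobian_gram hγ.le θ), fun est hest hunb => ?_⟩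
  set E := complementMatrix L Et with hE
  have hunb1 := hunb.elim (fun h => h.isUnbiasedToFirstOrder hθ) id
  have hk := memLp_pi_iff.mp hest
  have hu := memLp_sub_signal γ θ
  have hprob : IsProbabilityMeasure (law γ θ) := isProbabilityMeasure_complexGaussian _
  have hDE : crossMoment (law γ θ) est (fun y => y - signal γ θ) * (signalJacobian γ θ * E) = E := by
    refine Matrix.ext_of_mulVec_single fun j => ?_
    rw [← mulVec_mulVec, ← mulVec_mulVec]
    exact crossMoment_noise_mulVec hest hunb1 (add_smul_mem_paramSpace hθ hEt0 _)
  have hunit : IsUnit (Eᴴ * fisherInfo γ θ * E) := by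
    rw [hJ]
    refine isUnit_conjTranspose_mul_mul_of_leftInverse
      (T := Eᴴ * crossMoment (law γ θ) est (fun y => y - signal γ θ)) ?_
    rw [Matrix.mul_assoc, hDE, complementMatrix_gram hEt]
  refine ⟨hunit, ?_⟩
  set mean : Idx L (N * (M + L)) → ℂ := fun k => ∫ y, est y k ∂law γ θ with hmean
  have hmeanL : ∀ k, MemLp (fun _ : Fin (N * (M + L) + L) → ℂ => mean k) 2 (law γ θ) :=
    fun k => memLp_const _
  -- The noise has mean zero, so subtracting a constant from the estimator leaves its correlation
  -- with the noise unchanged.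
  have hcentred : crossMoment (law γ θ) (fun y => est y - mean) (fun y => y - signal γ θ)
      = crossMoment (law γ θ) est (fun y => y - signal γ θ) := by
    have h0 : crossMoment (law γ θ) (fun _ => mean) (fun y => y - signal γ θ) = 0 := by
      ext k i
      have h := integral_complexGaussian_sub (signal γ θ) i
      simp only [crossMoment, of_apply, integral_const_mul, Complex.star_def, integral_conj,
        Pi.sub_apply, law_eq_complexGaussian, h, map_zero, mul_zero, Matrix.zero_apply]
    rw [crossMoment_sub_left hk hmeanL hu, h0, sub_zero]
  have he : ∀ k, MemLp (fun y => (est y - mean) k) 2 (law γ θ) := fun k => (hk k).sub (hmeanL k)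
  have hs : score γ θ = fun y => (signalJacobian γ θ)ᴴ *ᵥ (y - signal γ θ) :=
    funext (score_eq γ θ)
  refine posSemidef_crossMoment_sub (e := fun y => est y - mean) he (v := score γ θ) ?_ ?_ hunit
  · rw [hs]
    exact memLp_mulVec _ hu
  · rw [hs, crossMoment_mulVec_right _ hu he, hcentred, conjTranspose_conjTranspose,
      Matrix.mul_assoc, hDE]
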